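/- **Setting.** An instance of the (unrooted) repairman problem consists of $n\ge 1$ service requests, each with a location in a metric space (the distances of a weighted metric graph) and a half-open time window. A service run at speed $\sigma$ starts anywhere at any time, moves with speed at most $\sigma$, and services requests by being at their locations during their windows; its profit is the number of requests serviced. For $\alpha>0$ and $\theta\in\mathbb R$, the set of periods with length $\alpha$ and starting point $\theta$ consists of the intervals $[\theta+z\alpha,\theta+(z+1)\alpha)$, $z\in\mathbb Z$. A window is in $W_\ell$ with respect to a set of periods if it completely fills exactly $\ell$ of them; no window is to start at the beginning of a period, so a period that begins exactly where the window starts is not counted (as if the divisions were moved back infinitesimally). Trimming cuts a window down to one of the periods that it completely fills, or lets it vanish. Let $m$ be the number of essentially different sets of periods of length $1/2$, that is, the number of distinct residues modulo $1/2$ of the endpoints of the windows. **Algorithm.** Suppose that, for runs at speed $s$, there is a $\gamma$-approximation subroutine REPAIRMAN for trimmed instances (every nonempty window is one of the periods of a single set of periods) which takes at most $\Gamma(n)$ steps, where $\Gamma(n)\ge n$. SPEEDUP, for a period length $\alpha$, a starting point $\theta$ and a rule that says which full period is kept for windows in $W_1,W_2,W_3$, trims with respect to the sets of periods with length $\alpha$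 and starting points $\theta+j\alpha/r$ $(0\le j<r)$, where $s=q/r$, calls REPAIRMAN on each trimmed instance and keeps the best run; if there are fewer than $r$ essentially different sets of periods of length $\alpha$, or if no $r$ is given, it uses one representative of each of these instead. SPEEDUPW12 keeps the best run from these calls of SPEEDUP: $\alpha=1/2$, $\theta\in\{0,1/4\}$, trimming windows in $W_1,W_2,W_3$ to their 1st, $j$th, $k$th full period, for all $j\in\{1,2\}$, $k\in\{1,2,3\}$; $\alpha=3/4$, $\theta\in\{0,1/4,1/2\}$, trimming windows in $W_1,W_2$ to their 1st, $j$th full period, for all $j\in\{1,2\}$; and $\alpha=1$, $\theta\in\{0,1/4,1/2,3/4\}$, trimming windows in $W_1$ to their only full period. All other windows vanish. **Theorem.** Let $1\le s\le 2$. 1. If $s=q/r$ with integers $q\ge 0$, $r\ge 1$, then SPEEDUPW12 finds a service run at speed $s$ in $O(\min\{r,m\}\,\Gamma(n))$ steps, with an absolute constant. If moreover, for some $i\in\{0,1\}$, all windows are in $W_2$ with respect to each of the $r$ sets of periods with length $1/2$ and starting points $i/4+j/(2r)$, $0\le j<r$, then this run is an $8\gamma/(s+1)$-approximation: every service run at unit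 speed has profit at most $\frac{8\gamma}{s+1}$ times its profit. 2. For arbitrary real $s$, the version of SPEEDUPW12 that tries all essentially different sets of periods finds a service run at speed $s$ in $O(m\,\Gamma(n))$ steps, with an absolute constant. If all windows are in $W_2$ with respect to every set of periods of length $1/2$, then this run is an $8\gamma/(s+1)$-approximation in the same sense. -/

import Mathlib

noncomputable section

namespace Repairman

/-! ### The unrooted repairman problem with time windows -/

/-- A service request: a location and a half-open time window `[start, finish)`. -/
structure Request (V : Type*) where
  node : V
  start : ℝ
  finish : ℝ

/-- An instance with `n` service requests. -/
abbrev Instance (V : Type*) (n : ℕ) := Fin n → Request V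

/-- A service run, given by its stops in order: which request is serviced, and when. -/
abbrev Run (n : ℕ) := List (Fin n × ℝ)

/-- `R` is a service run for `I` at speed `s`: no request is serviced twice, every stop lies in
the time window of its request, and the distance between consecutive stops can be travelled at
speed `s` in the time between them.  The run may start anywhere and at any time. -/
def IsRun {V : Type*} [PseudoMetricSpace V] {n : ℕ} (s : ℝ) (I : Instance V n) (R : Run n) :
    Prop :=
  (R.map Prod.fst).Nodup ∧
  (∀ p ∈ R, p.2 ∈ Set.Ico (I p.1).start (I p.1).finish) ∧
  R.IsChain (fun p q => dist (I p.1).node (I q.1).node ≤ s * (q.2 - p.2))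

/-- The profit of a run is the number of requests that it services. -/
def profit {n : ℕ} (R : Run n) : ℕ := R.length

/-! ### Periods and trimming

The set of periods of length `α` with starting point `θ` consists of the intervals
`[θ + z * α, θ + (z + 1) * α)`, for integers `z`. -/

/-- The window of `q` completely fills exactly `ℓ` periods of the set with length `α` and starting
point `θ`.  No window is to start at the beginning of a period: a period beginning exactly where
the window starts is not counted, as if the divisions had been moved back by an infinitesimal
amount.  For a window that does not start at a division this is plain containment. -/
def InW {V : Type*} (ℓ : ℕ) (α θ : ℝ) (q : Request V) : Prop :=
  {z : ℤ | q.start < θ + z * α ∧ θ + (z + 1) * α ≤ q.finish}.ncard = ℓ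

/-- Index of the first period that begins after the start of the window. -/
def firstPeriod {V : Type*} (α θ : ℝ) (q : Request V) : ℤ := ⌊(q.start - θ) / α⌋ + 1

/-- The number of completely filled periods, as the algorithm computes it. -/
def fullPeriods {V : Type*} (α θ : ℝ) (q : Request V) : ℕ :=
  (⌊(q.finish - θ) / α⌋ - firstPeriod α θ q).toNat

theorem inW_iff_fullPeriods {V : Type*} (ℓ : ℕ) {α : ℝ} (hα : 0 < α) (θ : ℝ) (q : Request V) :
    InW ℓ α θ q ↔ fullPeriods α θ q = ℓ := by
  have h : {z : ℤ | q.start < θ + z * α ∧ θ + (z + 1) * α ≤ q.finish} =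
      ((Finset.Ico (firstPeriod α θ q) ⌊(q.finish - θ) / α⌋ : Finset ℤ) : Set ℤ) := by
    ext z
    have h1 : q.start < θ + z * α ↔ firstPeriod α θ q ≤ z := by
      rw [firstPeriod, Int.add_one_le_iff, Int.floor_lt, div_lt_iff₀ hα]
      constructor <;> intro h <;> linarith
    have h2 : θ + (z + 1) * α ≤ q.finish ↔ z < ⌊(q.finish - θ) / α⌋ := by
      rw [← Int.add_one_le_iff, Int.le_floor, le_div_iff₀ hα]
      push_cast
      constructor <;> intro h <;> linarith
    simp [h1, h2]
  rw [InW, h, Set.ncard_coe_finset, Int.card_Ico, fullPeriods]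

/-- A trimming choice is a list of positive integers: a window that completely fills `ℓ ≥ 1` periods
is cut down to one of these, and the `ℓ`-th entry of the list says to which (counted from 1).
There is no choice for `ℓ = 0` and for `ℓ` beyond the length of the list. -/
def keptPeriod (choice : List ℕ) : ℕ → Option ℕ
  | 0 => none
  | ℓ + 1 => choice[ℓ]?

/-- The window `[θ + z * α, θ + (z + 1) * α)` at the same location as `q`. -/
def toPeriod {V : Type*} (α θ : ℝ) (z : ℤ) (q : Request V) : Request V :=
  ⟨q.node, θ + z * α, θ + (z + 1) * α⟩

/-- Trim one window to the chosen period.  Windows without a choice vanish: they become empty. -/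
def trimRequest {V : Type*} (α θ : ℝ) (c : List ℕ) (q : Request V) : Request V :=
  match keptPeriod c (fullPeriods α θ q) with
  | none => ⟨q.node, q.start, q.start⟩
  | some j => toPeriod α θ (firstPeriod α θ q + j - 1) q

/-- Trim all windows. -/
def trim {V : Type*} {n : ℕ} (α θ : ℝ) (c : List ℕ) (I : Instance V n) : Instance V n :=
  fun p => trimRequest α θ c (I p)

/-- A trimmed instance: every window is empty or one of the periods of a single set of periods
(so nonempty windows are pairwise identical or disjoint). -/
def IsTrimmed {V : Type*} {n : ℕ} (T : Instance V n) : Prop :=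
  ∃ α θ : ℝ, 0 < α ∧ ∀ p, (T p).finish ≤ (T p).start ∨
    ∃ z : ℤ, (T p).start = θ + z * α ∧ (T p).finish = θ + (z + 1) * α

/-! ### Step counting -/

/-- A computation with its result and the number of its elementary steps (comparisons and
arithmetic operations, rounding included, on real numbers, up to a constant factor). -/
structure Timed (β : Type) where
  val : β
  steps : ℕ

instance : Monad Timed where
  pure a := ⟨a, 0⟩
  bind x f := ⟨(f x.val).val, x.steps + (f x.val).steps⟩

/-- Spend `k` elementary steps. -/
def tick (k : ℕ) : Timed Unit := ⟨(), k⟩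

/-- A subroutine for repairman instances over `V`. -/
abbrev Solver (V : Type*) := ∀ n : ℕ, Instance V n → Timed (Run n)

/-- At speed `s` the subroutine is a `γ`-approximation for trimmed instances that takes at most
`Γ n` steps on `n` requests. -/
def IsApproxSolver {V : Type*} [PseudoMetricSpace V] (s γ : ℝ) (Γ : ℕ → ℕ)
    (repairman : Solver V) : Prop :=
  ∀ (n : ℕ) (T : Instance V n), IsTrimmed T →
    IsRun s T (repairman n T).val ∧
    (∀ R : Run n, IsRun s T R → (profit R : ℝ) ≤ γ * profit (repairman n T).val) ∧
    (repairman n T).steps ≤ Γ n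

/-! ### The algorithm -/

/-- The position of the time `x` within its period, for periods of length `α` starting at `θ`. -/
def residue (α θ x : ℝ) : ℝ := α * Int.fract ((x - θ) / α)

/-- The window endpoints of `I`, reduced modulo the periods.  Moving the divisions does not change
which periods are filled by which windows as long as no division passes a window endpoint. -/
def endpointResidues {V : Type*} {n : ℕ} (α θ : ℝ) (I : Instance V n) : List ℝ :=
  (List.ofFn fun p => residue α θ (I p).start) ++ (List.ofFn fun p => residue α θ (I p).finish)

open Classical in
/-- The number of distinct sets of periods of length `1/2`, that is, of essentially different
positions of the divisions relative to the windows. -/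
def numPeriodSets {V : Type*} {n : ℕ} (I : Instance V n) : ℕ :=
  (endpointResidues (1 / 2) 0 I).toFinset.card

open Classical in
/-- The shifts of the set of periods that have to be tried.  The distinct residues in the list are
collected in `acc` by linear search.  If `r` of them are found (for `r` given), the search stops,
and the `r` equally spaced shifts `0, α/r, …, (r - 1)α/r` are used instead of them. -/
def shifts (r : Option ℕ) (α : ℝ) (acc : List ℝ) : List ℝ → Timed (List ℝ)
  | [] => pure acc
  | x :: l => do
    tick (acc.length + 1)
    if x ∈ acc then
      shifts r α acc l
    else if r = some (acc.length + 1) then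
      tick (acc.length + 1)
      pure ((List.range (acc.length + 1)).map fun j => j * α / (acc.length + 1))
    else
      shifts r α (x :: acc) l

/-- For every shift `δ` in the list, trim with respect to the set of periods with starting point
`θ + δ` and call the subroutine; retain the best run. -/
def bestRun {V : Type*} {n : ℕ} (repairman : Solver V) (I : Instance V n) (α θ : ℝ) (c : List ℕ)
    (best : Run n) : List ℝ → Timed (Run n)
  | [] => pure best
  | δ :: l => do
    tick (n + 1)
    let R ← repairman n (trim α (θ + δ) c I)
    tick (best.length + R.length + 1)
    bestRun repairman I α θ c (if profit best < profit R then R else best) l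

/-- The procedure SPEEDUP for periods of length `α`, starting point `θ` and trimming choice `c`;
it retains the best run found so far. -/
def speedup {V : Type*} {n : ℕ} (repairman : Solver V) (r : Option ℕ) (I : Instance V n)
    (best : Run n) (α θ : ℝ) (c : List ℕ) : Timed (Run n) := do
  tick (2 * n)
  let L ← shifts r α [] (endpointResidues α θ I)
  bestRun repairman I α θ c best L

/-- The period length, starting point and trimming choice of each call of SPEEDUP, phase by
phase. -/
def calls : List (ℝ × ℝ × List ℕ) :=
  ((List.range 2).flatMap fun i => [1, 2].flatMap fun j => [1, 2, 3].map fun k =>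
    (1 / 2, (i : ℝ) / 4, [1, j, k])) ++
  ((List.range 3).flatMap fun i => [1, 2].map fun j => (3 / 4, (i : ℝ) / 4, [1, j])) ++
  ((List.range 4).map fun i => (1, (i : ℝ) / 4, [1]))

/-- Make the listed calls of SPEEDUP one after the other. -/
def runCalls {V : Type*} {n : ℕ} (repairman : Solver V) (r : Option ℕ) (I : Instance V n)
    (best : Run n) : List (ℝ × ℝ × List ℕ) → Timed (Run n)
  | [] => pure best
  | (α, θ, c) :: l => do
    tick 1
    let R ← speedup repairman r I best α θ c
    runCalls repairman r I R l

/-- The algorithm SPEEDUPW12.  The parameter `r` is `some r` if the speedup is a fraction `q / r`,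
and `none` if all essentially different sets of periods are to be tried. -/
def speedupW12 {V : Type*} {n : ℕ} (repairman : Solver V) (r : Option ℕ) (I : Instance V n) :
    Timed (Run n) :=
  runCalls repairman r I [] calls

end Repairman

end

/-!
A unit speed run is turned into runs at speed `s = 1 + τ` on the instances trimmed with respect to
periods of length `1 / 2`; only the calls that keep the first full period are needed for the
approximation factor.  Take one period as the unit of time.

A *zigzag run* travels along the unit speed run, regarded as a line parametrized by its own time,
and advances by two periods in any two periods.  In every second period `k` it moves forward all
the time and sweeps `k + [β, β + 1 + τ)`; in the others it moves back by `τ - c`, sweeps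
`k + [β + c, β + c + 1)` moving forward, and moves back by `c`.  It serves the requests whose
trimmed window is period `k` and whose delay `v` (the time at which the unit speed run serves the
request, minus `k`) lies in the respective interval.  Taken together, the zigzag runs of both
parities count a request once for `v ∈ [β, β + 1 + τ)` and once for `v ∈ [β + c, β + c + 1)`; this
is `sum_zigzag_le`.

A window that fills two periods for each of the `r` equally spaced shifts has, over these shifts,
`r` equally spaced delays in a window of length one inside `[-1, 3)` (`mul_delay`,
`delay_lt_three`).  A suitable mixture of 24 pairs `(β, c)`, depending on whether `τ ≤ 1 / 2`,
covers every such window of length one at least as often as a uniform distribution of the total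
length `2 + τ` over `[-1, 3)` would: `coverage_of_two_mul_le` and `coverage_of_le_two_mul`.
Averaging over shifts, parities and the mixture, some trimmed instance admits at least the fraction
`(2 + τ) / 8 = (s + 1) / 8` of the unit speed profit (`profit_le_of_shifts`).

If the algorithm tries residues of window endpoints instead of the equally spaced shifts, nothing
is lost, because moving the divisions up to the next endpoint only translates the trimmed instance
(`exists_residue_floor_eq`, `exists_isRun_trim_of_floor_eq`).  A real speed is approximated from
below by fractions (`add_one_mul_le_of_fractions`).  The number of steps is linear in the number of
shifts, and the residues modulo `3 / 4` and modulo `1` are at most three times as many as the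
residues modulo `1 / 2` (`card_endpointResidues_le`).
-/

noncomputable section

namespace Repairman

/-! ### Runs obtained by rescheduling -/

/-- Stops may be listed in any order as long as their travel times fit: sorting them by time gives
a service run. -/
theorem exists_isRun_of_dist_le {V : Type*} [PseudoMetricSpace V] {n : ℕ} {s : ℝ}
    {I : Instance V n} (A : Finset (Fin n × ℝ)) (hA : Set.InjOn Prod.fst (A : Set (Fin n × ℝ)))
    (T : Fin n × ℝ → ℝ) (hT : ∀ p ∈ A, T p ∈ Set.Ico (I p.1).start (I p.1).finish)
    (hd : ∀ p ∈ A, ∀ p' ∈ A, dist (I p.1).node (I p'.1).node ≤ s * |T p - T p'|) :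
    ∃ R : Run n, IsRun s I R ∧ profit R = A.card := by
  classical
  set L : Run n := A.toList.map fun p => (p.1, T p) with hL
  set R : Run n := L.insertionSort (fun x y => x.2 ≤ y.2) with hR
  have hperm : R.Perm L := List.perm_insertionSort _ _
  have hmem : ∀ x ∈ R, ∃ p ∈ A, x = (p.1, T p) := by
    intro x hx
    obtain ⟨p, hp, rfl⟩ := List.mem_map.1 (hperm.mem_iff.1 hx)
    exact ⟨p, Finset.mem_toList.1 hp, rfl⟩
  have htot : Std.Total (fun x y : Fin n × ℝ => x.2 ≤ y.2) := ⟨fun x y => le_total x.2 y.2⟩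
  have htr : IsTrans (Fin n × ℝ) (fun x y => x.2 ≤ y.2) := ⟨fun x y z h h' => le_trans h h'⟩
  have hsort : R.Pairwise (fun x y => x.2 ≤ y.2) := List.pairwise_insertionSort _ _
  refine ⟨R, ⟨?_, ?_, ?_⟩, ?_⟩
  · rw [(hperm.map Prod.fst).nodup_iff, hL, List.map_map]
    refine List.Nodup.map_on ?_ A.nodup_toList
    intro p hp p' hp' h
    exact hA (Finset.mem_toList.1 hp) (Finset.mem_toList.1 hp') h
  · intro x hx
    obtain ⟨p, hp, rfl⟩ := hmem x hx
    exact hT p hp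
  · refine List.Pairwise.isChain (List.Pairwise.imp_of_mem ?_ hsort)
    intro x y hx hy hxy
    obtain ⟨p, hp, rfl⟩ := hmem x hx
    obtain ⟨p', hp', rfl⟩ := hmem y hy
    have h := hd p hp p' hp'
    rwa [abs_sub_comm, abs_of_nonneg (by simpa using hxy)] at h
  · rw [profit, hperm.length_eq, hL, List.length_map, Finset.length_toList]

/-- Any two stops of a run, not only consecutive ones, can be reached from each other in time. -/
theorem IsRun.dist_le {V : Type*} [PseudoMetricSpace V] {n : ℕ} {s : ℝ} {I : Instance V n}
    {R : Run n} (h : IsRun s I R) (hs : 0 ≤ s) {p p' : Fin n × ℝ} (hp : p ∈ R) (hp' : p' ∈ R) :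
    dist (I p.1).node (I p'.1).node ≤ s * |p.2 - p'.2| := by
  have htr : IsTrans (Fin n × ℝ) (fun p q => dist (I p.1).node (I q.1).node ≤ s * (q.2 - p.2)) :=
    ⟨fun x y z h h' => by
      have := dist_triangle (I x.1).node (I y.1).node (I z.1).node
      linarith⟩
  have hpw := List.isChain_iff_pairwise.1 h.2.2
  have hsymm : Std.Symm (fun p p' : Fin n × ℝ =>
      dist (I p.1).node (I p'.1).node ≤ s * |p.2 - p'.2|) :=
    ⟨fun x y h => by rwa [dist_comm, abs_sub_comm]⟩
  refine List.Pairwise.forall_of_forall (R := fun p p' : Fin n × ℝ =>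
    dist (I p.1).node (I p'.1).node ≤ s * |p.2 - p'.2|) ?_ ?_ hp hp'
  · intro x _
    simp
  · refine hpw.imp ?_
    intro x y h
    refine h.trans (mul_le_mul_of_nonneg_left ?_ hs)
    rw [abs_sub_comm]
    exact le_abs_self _

/-! ### Zigzag runs -/

/-- The point of the unit speed run reached by the zigzag run at the integer time `k`: it runs
through `k + β` if `k + π` is even, and is `τ` ahead of that if `k + π` is odd. -/
def zigzagPos (β τ : ℝ) (π k : ℤ) : ℝ := k + β + if Even (k + π) then 0 else τ

/-- The position `u` on the unit speed run is served in period `k` by the zigzag run with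
parameters `β`, `c`, `τ` and parity `π`. -/
def ZigzagServes (β c τ : ℝ) (π k : ℤ) (u : ℝ) : Prop :=
  if Even (k + π) then β ≤ u - k ∧ u - k < β + 1 + τ else β + c ≤ u - k ∧ u - k < β + c + 1

/-- The time in period `k` at which the zigzag run serves the position `u`: for `k + π` even it
moves forward all the time, and for `k + π` odd it first moves back by `τ - c`. -/
def zigzagTime (β c τ : ℝ) (π k : ℤ) (u : ℝ) : ℝ :=
  k + (u - k - β + if Even (k + π) then 0 else τ - 2 * c) / (1 + τ)

section Zigzag

variable {β c τ : ℝ} {π k : ℤ} {u : ℝ}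

theorem zigzagTime_mem (hc : 0 ≤ c) (hcτ : c ≤ τ) (h : ZigzagServes β c τ π k u) :
    (k : ℝ) ≤ zigzagTime β c τ π k u ∧ zigzagTime β c τ π k u < k + 1 := by
  have hs : 0 < 1 + τ := by linarith
  unfold ZigzagServes at h
  unfold zigzagTime
  constructor
  · refine le_add_of_nonneg_right (div_nonneg ?_ hs.le)
    split_ifs at h ⊢ <;> linarith
  · refine add_lt_add_right ((div_lt_one hs).2 ?_) _
    split_ifs at h ⊢ <;> linarith

theorem mul_zigzagTime_sub (hτ : 0 ≤ τ) : (1 + τ) * (zigzagTime β c τ π k u - k) =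
    u - k - β + if Even (k + π) then 0 else τ - 2 * c := by
  have hs : (1 + τ) ≠ 0 := by positivity
  unfold zigzagTime
  rw [add_sub_cancel_left, mul_div_cancel₀ _ hs]

theorem abs_sub_zigzagPos_le (hc : 0 ≤ c) (hcτ : c ≤ τ) (h : ZigzagServes β c τ π k u) :
    |u - zigzagPos β τ π k| ≤ (1 + τ) * (zigzagTime β c τ π k u - k) := by
  rw [mul_zigzagTime_sub (hc.trans hcτ), abs_le]
  unfold ZigzagServes at h
  unfold zigzagPos
  constructor <;> split_ifs at h ⊢ <;> linarith

theorem abs_zigzagPos_add_one_sub_le (hc : 0 ≤ c) (hcτ : c ≤ τ)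
    (h : ZigzagServes β c τ π k u) :
    |zigzagPos β τ π (k + 1) - u| ≤ (1 + τ) * (k + 1 - zigzagTime β c τ π k u) := by
  have e : (1 + τ) * (k + 1 - zigzagTime β c τ π k u) =
    (1 + τ) - (1 + τ) * (zigzagTime β c τ π k u - k) := by ring
  rw [e, mul_zigzagTime_sub (hc.trans hcτ), abs_le]
  unfold ZigzagServes at h
  unfold zigzagPos
  have hpar : Even (k + 1 + π) ↔ ¬ Even (k + π) := by
    rw [add_right_comm, Int.even_add_one]
  push_cast
  simp only [hpar]
  constructor <;> split_ifs at h ⊢ <;> linarith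

theorem abs_zigzagPos_sub_le (hτ : 0 ≤ τ) {k' : ℤ} (hk : k ≤ k') :
    |zigzagPos β τ π k' - zigzagPos β τ π k| ≤ (1 + τ) * (k' - k) := by
  rcases hk.eq_or_lt with rfl | hk
  · simp
  · have h1 : (1 : ℝ) ≤ k' - k := by
      have : (1 : ℤ) ≤ k' - k := by omega
      exact_mod_cast this
    have h2 : τ ≤ τ * (k' - k) := le_mul_of_one_le_right hτ h1
    unfold zigzagPos
    rw [abs_le]
    constructor <;> split_ifs <;> linarith

/-- The zigzag run moves along the unit speed run with speed at most `1 + τ`. -/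
theorem abs_sub_le_mul_abs_zigzagTime_sub (hc : 0 ≤ c) (hcτ : c ≤ τ) {k' : ℤ} {u' : ℝ}
    (h : ZigzagServes β c τ π k u) (h' : ZigzagServes β c τ π k' u') :
    |u - u'| ≤ (1 + τ) * |zigzagTime β c τ π k u - zigzagTime β c τ π k' u'| := by
  wlog hk : k ≤ k' generalizing k k' u u'
  · rw [abs_sub_comm, abs_sub_comm (zigzagTime _ _ _ _ _ _)]
    exact this h' h (le_of_not_ge hk)
  have hτ : 0 ≤ τ := hc.trans hcτ
  rcases hk.eq_or_lt with rfl | hk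
  · have e : (1 + τ) * (zigzagTime β c τ π k u - zigzagTime β c τ π k u') = u - u' := by
      have h1 := mul_zigzagTime_sub (β := β) (c := c) (π := π) (k := k) (u := u) hτ
      have h2 := mul_zigzagTime_sub (β := β) (c := c) (π := π) (k := k) (u := u') hτ
      linarith
    rw [← e, abs_mul, abs_of_nonneg (by linarith : 0 ≤ 1 + τ)]
  · have h1 := abs_le.1 (abs_zigzagPos_add_one_sub_le hc hcτ h)
    have h2 := abs_le.1 (abs_sub_zigzagPos_le hc hcτ h')
    have h3 := abs_le.1 (abs_zigzagPos_sub_le (β := β) (π := π) hτ (k := k + 1) (k' := k')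
      (by omega))
    push_cast at h3
    have h4 : (1 + τ) * (zigzagTime β c τ π k' u' - zigzagTime β c τ π k u) ≤
        (1 + τ) * |zigzagTime β c τ π k u - zigzagTime β c τ π k' u'| := by
      refine mul_le_mul_of_nonneg_left ?_ (by linarith)
      rw [abs_sub_comm]
      exact le_abs_self _
    rw [abs_le]
    constructor <;> linarith [h1.1, h1.2, h2.1, h2.2, h3.1, h3.2]

end Zigzag

open Classical in
/-- A zigzag run of either parity serves requests of a trimmed instance.  Over both parities, a
stop of the unit speed run with delay `v` relative to its trimmed window is counted once for
`v ∈ [β, β + 1 + τ)` and once for `v ∈ [β + c, β + c + 1)`. -/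
theorem sum_zigzag_le {V : Type*} [PseudoMetricSpace V] {n : ℕ} {s X α θ : ℝ}
    {I T : Instance V n} {A : Finset (Fin n × ℝ)} {K : Fin n × ℝ → ℤ} {β c τ : ℝ} (hα : 0 < α)
    (hA : Set.InjOn Prod.fst (A : Set (Fin n × ℝ)))
    (hd : ∀ p ∈ A, ∀ p' ∈ A, dist (I p.1).node (I p'.1).node ≤ |p.2 - p'.2|)
    (hT : ∀ p ∈ A, T p.1 = toPeriod α θ (K p) (I p.1))
    (hc : 0 ≤ c) (hcτ : c ≤ τ) (hs : 1 + τ ≤ s)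
    (hX : ∀ R : Run n, IsRun s T R → (profit R : ℝ) ≤ X) :
    ∑ p ∈ A,
      ((if β ≤ (p.2 - θ) / α - K p ∧ (p.2 - θ) / α - K p < β + 1 + τ then (1 : ℝ) else 0) +
       (if β + c ≤ (p.2 - θ) / α - K p ∧ (p.2 - θ) / α - K p < β + c + 1 then (1 : ℝ) else 0))
      ≤ 2 * X := by
  have key : ∀ π : ℤ,
      ∑ p ∈ A, (if ZigzagServes β c τ π (K p) ((p.2 - θ) / α) then (1 : ℝ) else 0) ≤ X := by
    intro π
    set B := A.filter fun p => ZigzagServes β c τ π (K p) ((p.2 - θ) / α) with hB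
    have hBA : ∀ p ∈ B, p ∈ A := fun p hp => (Finset.mem_filter.1 hp).1
    have hBs : ∀ p ∈ B, ZigzagServes β c τ π (K p) ((p.2 - θ) / α) :=
      fun p hp => (Finset.mem_filter.1 hp).2
    obtain ⟨R, hR, hRB⟩ := exists_isRun_of_dist_le (s := s) (I := T) B
      (hA.mono fun p hp => hBA p hp)
      (fun p => θ + zigzagTime β c τ π (K p) ((p.2 - θ) / α) * α) (by
        intro p hp
        obtain ⟨h1, h2⟩ := zigzagTime_mem hc hcτ (hBs p hp)
        rw [hT p (hBA p hp)]
        exact ⟨by simpa [toPeriod] using mul_le_mul_of_nonneg_right h1 hα.le,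
          by simpa [toPeriod] using mul_lt_mul_of_pos_right h2 hα⟩) (by
        intro p hp p' hp'
        have h1 := abs_sub_le_mul_abs_zigzagTime_sub hc hcτ (hBs p hp) (hBs p' hp')
        have h2 := hd p (hBA p hp) p' (hBA p' hp')
        rw [hT p (hBA p hp), hT p' (hBA p' hp')]
        refine h2.trans ?_
        have e1 : p.2 - p'.2 = ((p.2 - θ) / α - (p'.2 - θ) / α) * α := by
          field_simp
          ring
        rw [e1, add_sub_add_left_eq_sub, ← sub_mul, abs_mul, abs_mul, abs_of_pos hα, ← mul_assoc]
        refine mul_le_mul_of_nonneg_right (h1.trans ?_) hα.le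
        exact mul_le_mul_of_nonneg_right hs (abs_nonneg _))
    have h := hX R hR
    rw [hRB, hB, Finset.card_filter] at h
    push_cast at h
    exact h
  have h0 := key 0
  have h1 := key 1
  have hsum : ∀ p : Fin n × ℝ,
      ((if β ≤ (p.2 - θ) / α - K p ∧ (p.2 - θ) / α - K p < β + 1 + τ then (1 : ℝ) else 0) +
       (if β + c ≤ (p.2 - θ) / α - K p ∧ (p.2 - θ) / α - K p < β + c + 1 then (1 : ℝ) else 0))
      = (if ZigzagServes β c τ 0 (K p) ((p.2 - θ) / α) then (1 : ℝ) else 0) +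
        (if ZigzagServes β c τ 1 (K p) ((p.2 - θ) / α) then (1 : ℝ) else 0) := by
    intro p
    unfold ZigzagServes
    by_cases hp : Even (K p)
    · simp only [add_zero, Int.even_add_one, hp, not_true_eq_false, if_true, if_false]
    · simp only [add_zero, Int.even_add_one, hp, not_false_eq_true, if_true, if_false]
      rw [add_comm]
  simp only [hsum]
  rw [Finset.sum_add_distrib]
  linarith

/-! ### Counting shifts -/

/-- The value `x` clamped to the interval `[0, r]`. -/
def clampTo (r x : ℤ) : ℤ := max 0 (min x r)

theorem clampTo_of_nonpos {r x : ℤ} (h : x ≤ 0) : clampTo r x = 0 := by unfold clampTo; omega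

theorem clampTo_of_ge {r x : ℤ} (h0 : 0 ≤ r) (h : r ≤ x) : clampTo r x = r := by
  unfold clampTo; omega

theorem clampTo_of_mem {r x : ℤ} (h0 : 0 ≤ x) (h : x ≤ r) : clampTo r x = x := by
  unfold clampTo; omega

theorem clampTo_of_nonneg {r x : ℤ} (hr : 0 ≤ r) (h : 0 ≤ x) : clampTo r x = min x r := by
  unfold clampTo; omega

theorem clampTo_of_le {r x : ℤ} (h : x ≤ r) : clampTo r x = max 0 x := by
  unfold clampTo; omega

/-- The number of elements of `[a, b)` among the `r` integers `m - r, …, m - 1`. -/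
theorem sum_range_ite_mem_Ico (r : ℕ) (m : ℤ) {a b : ℤ} (hab : a ≤ b) :
    ∑ i ∈ Finset.range r, (if a ≤ m + i - r ∧ m + i - r < b then (1 : ℤ) else 0) =
      clampTo r (m - a) - clampTo r (m - b) := by
  rw [← Finset.sum_filter, Finset.sum_const]
  have : (Finset.range r).filter (fun i : ℕ => a ≤ m + i - r ∧ m + i - r < b) =
      Finset.Ico (r - clampTo r (m - a)).toNat (r - clampTo r (m - b)).toNat := by
    ext i
    simp only [Finset.mem_filter, Finset.mem_range, Finset.mem_Ico]
    unfold clampTo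
    omega
  simp only [nsmul_eq_mul, mul_one]
  rw [this, Nat.card_Ico]
  unfold clampTo
  omega

theorem toNat_emod_lt {r : ℕ} (hr : 0 < r) (x : ℤ) : (x % r).toNat < r := by
  have hr' : (0 : ℤ) < r := by exact_mod_cast hr
  have h1 := Int.emod_nonneg x hr'.ne'
  have h2 := Int.emod_lt_of_pos x hr'
  omega

/-- The map `j ↦ (N - j) % r` is an involution of `{0, …, r - 1}`. -/
theorem sub_emod_sub_emod {r j : ℕ} (hj : j < r) (N : ℤ) :
    ((N - (((N - j) % r).toNat : ℕ)) % r).toNat = j := by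
  have hr' : (0 : ℤ) < r := by omega
  have h1 := Int.emod_nonneg (N - j) hr'.ne'
  rw [Int.toNat_of_nonneg h1, Int.sub_emod, Int.emod_emod_of_dvd _ dvd_rfl,
    ← Int.sub_emod, sub_sub_cancel, Int.emod_eq_of_lt (by omega) (by exact_mod_cast hj)]
  simp

theorem sum_range_sub_emod {M : Type*} [AddCommMonoid M] {r : ℕ} (hr : 0 < r) (N : ℤ)
    (f : ℕ → M) :
    ∑ j ∈ Finset.range r, f ((N - j) % r).toNat = ∑ i ∈ Finset.range r, f i :=
  Finset.sum_nbij' (fun j => ((N - j) % r).toNat) (fun j => ((N - j) % r).toNat)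
    (fun _ _ => Finset.mem_range.2 (toNat_emod_lt hr _))
    (fun _ _ => Finset.mem_range.2 (toNat_emod_lt hr _))
    (fun _ hj => sub_emod_sub_emod (Finset.mem_range.1 hj) N)
    (fun _ hj => sub_emod_sub_emod (Finset.mem_range.1 hj) N) (fun _ _ => rfl)

/-- The fractional parts of `x - j / r` for `j < r` are equally spaced. -/
theorem mul_fract_sub_div {r : ℕ} (hr : 0 < r) (x : ℝ) (j : ℕ) :
    r * Int.fract (x - j / r) = Int.fract (r * x) + (((⌊r * x⌋ - j) % r).toNat : ℕ) := by
  have hr' : (0 : ℤ) < r := by exact_mod_cast hr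
  have hr0 : (0 : ℝ) < r := by exact_mod_cast hr
  set N : ℤ := ⌊r * x⌋ - j with hN
  set i : ℤ := N % r with hi
  have hi0 : 0 ≤ i := Int.emod_nonneg _ hr'.ne'
  have hir : i < r := Int.emod_lt_of_pos _ hr'
  have hdiv : (N : ℝ) = r * (N / r : ℤ) + i := by
    exact_mod_cast (Int.mul_ediv_add_emod N r).symm
  have hcast : (((N % r).toNat : ℕ) : ℝ) = i := by
    rw [← hi]
    exact_mod_cast Int.toNat_of_nonneg hi0
  rw [hcast]
  have hx : x - j / r = (N / r : ℤ) + (Int.fract (r * x) + i) / r := by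
    have h1 : (r : ℝ) * x = Int.fract (r * x) + j + N := by
      rw [hN]
      push_cast
      linarith [Int.fract_add_floor ((r : ℝ) * x)]
    rw [mul_comm (r : ℝ) x] at h1 ⊢
    field_simp
    linarith
  have hi0' : (0 : ℝ) ≤ i := by exact_mod_cast hi0
  have hir' : (i : ℝ) + 1 ≤ r := by exact_mod_cast hir
  have hf : Int.fract (x - j / r) = (Int.fract (r * x) + i) / r := by
    rw [hx, Int.fract_intCast_add, Int.fract_eq_self]
    have h0 := Int.fract_nonneg ((r : ℝ) * x)
    have h1 := Int.fract_lt_one ((r : ℝ) * x)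
    constructor
    · positivity
    · rw [div_lt_one hr0]
      linarith
  rw [hf, mul_div_cancel₀ _ hr0.ne']

/-- The number of services of a stop by the zigzag runs with parameters `b / r` and `c / r` of both
parities, over the `r` equally spaced shifts of the periods, if `m - r, …, m - 1` are the delays of
the stop, in units of `1 / r` and rounded down. -/
def coverage (r t m b c : ℤ) : ℤ :=
  clampTo r (m - b) - clampTo r (m - b - r - t) + (clampTo r (m - b - c) - clampTo r (m - b - c - r))

/-- For `2 * t ≤ r`, a mixture of total weight 24 and symmetric under reflection at `r` that covers any
`r` consecutive delays in `[-r, 3 * r)` at least as often as a uniform distribution of the total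
length `2 * r + t` over this interval would. -/
theorem coverage_of_two_mul_le {r t m : ℤ} (hr : 0 ≤ r) (ht : 0 ≤ t) (h2 : 2 * t ≤ r)
    (hm : 0 ≤ m) (hm' : m ≤ 3 * r) :
    6 * (2 * r + t) ≤ 6 * coverage r t m (-r) 0 + 2 * coverage r t m (-2 * t) t
      + coverage r t m 0 0 + 3 * coverage r t m t 0
      + 6 * coverage r t m (2 * r - t) t + 2 * coverage r t m (r + t) 0
      + coverage r t m (r - t) t + 3 * coverage r t m (r - 2 * t) t := by
  unfold coverage
  obtain h | h | h : m ≤ r ∨ (r ≤ m ∧ m ≤ 2 * r) ∨ 2 * r ≤ m := by omega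
  all_goals
    simp (disch := omega) only [clampTo_of_nonpos, clampTo_of_ge, clampTo_of_mem]
    try simp (disch := omega) only [clampTo_of_nonneg, clampTo_of_le]
  all_goals omega

/-- The analogue of `coverage_of_two_mul_le` for `r ≤ 2 * t`. -/
theorem coverage_of_le_two_mul {r t m : ℤ} (hr : 0 ≤ r) (ht : t ≤ r) (h2 : r ≤ 2 * t)
    (hm : 0 ≤ m) (hm' : m ≤ 3 * r) :
    6 * (2 * r + t) ≤ 6 * coverage r t m (-r) 0 + 2 * coverage r t m (-r) t
      + 4 * coverage r t m t 0
      + 6 * coverage r t m (2 * r - t) t + 2 * coverage r t m (2 * r - t) 0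
      + 4 * coverage r t m (r - 2 * t) t := by
  unfold coverage
  obtain h | h | h : m ≤ r ∨ (r ≤ m ∧ m ≤ 2 * r) ∨ 2 * r ≤ m := by omega
  all_goals
    simp (disch := omega) only [clampTo_of_nonpos, clampTo_of_ge, clampTo_of_mem]
    try simp (disch := omega) only [clampTo_of_nonneg, clampTo_of_le]
  all_goals omega

/-! ### Averaging over shifts and zigzag runs -/

/-- The delay of the time `x` relative to the first full period of the window of `a`, if the
periods are shifted by `j * α / r`, in units of `α / r`. -/
theorem mul_delay {V : Type*} {α : ℝ} (hα : 0 < α) {r : ℕ} (hr : 0 < r) (θ x : ℝ) (a : Request V)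
    (j : ℕ) :
    r * ((x - (θ + j * α / r)) / α - firstPeriod α (θ + j * α / r) a) =
      (r * ((x - a.start) / α) + Int.fract (r * ((a.start - θ) / α))) +
        (((⌊r * ((a.start - θ) / α)⌋ - j) % r).toNat : ℕ) - r := by
  have hr0 : (r : ℝ) ≠ 0 := by exact_mod_cast hr.ne'
  have e1 : ∀ y : ℝ, (y - (θ + j * α / r)) / α = (y - θ) / α - j / r := by
    intro y
    field_simp
    ring
  have h := mul_fract_sub_div hr ((a.start - θ) / α) j
  rw [firstPeriod, e1, e1, add_assoc, ← h, Int.fract]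
  push_cast
  have e2 : (x - a.start) / α = (x - θ) / α - (a.start - θ) / α := by ring
  rw [e2]
  ring

theorem delay_lt_three {V : Type*} {α θ x : ℝ} (hα : 0 < α) {a : Request V}
    (h : fullPeriods α θ a = 2) (hx : x < a.finish) :
    (x - θ) / α - firstPeriod α θ a < 3 := by
  have h1 : ⌊(a.finish - θ) / α⌋ = firstPeriod α θ a + 2 := by
    unfold fullPeriods at h
    omega
  have h2 := Int.lt_floor_add_one ((a.finish - θ) / α)
  rw [h1] at h2
  push_cast at h2
  have h3 : (x - θ) / α < (a.finish - θ) / α := by gcongr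
  linarith

theorem div_le_and_lt_div_iff {r : ℝ} (hr : 0 < r) (v : ℝ) (a b : ℤ) :
    ((a : ℝ) / r ≤ v ∧ v < b / r) ↔ (a ≤ ⌊r * v⌋ ∧ ⌊r * v⌋ < b) := by
  rw [Int.le_floor, Int.floor_lt, div_le_iff₀ hr, lt_div_iff₀ hr, mul_comm v]

/-- If all windows fill two periods for each of the `r` equally spaced shifts, and `X` bounds the
profit of the trimmed instances at speed `s ≥ q / r`, then unit speed profit is at most
`8 * X / (q / r + 1)`. -/
theorem profit_le_of_shifts {V : Type*} [PseudoMetricSpace V] {n : ℕ} {s X α θ : ℝ}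
    {I : Instance V n} {R : Run n} (hα : 0 < α) (hR : IsRun 1 I R) {q r : ℕ} (hr : 0 < r)
    (hrq : r ≤ q) (hq : q ≤ 2 * r) (hs : (q : ℝ) / r ≤ s) {c : List ℕ}
    (hc : keptPeriod c 2 = some 1)
    (hW : ∀ p, ∀ j < r, fullPeriods α (θ + j * α / r) (I p) = 2)
    (hX : ∀ j < r, ∀ R' : Run n, IsRun s (trim α (θ + j * α / r) c I) R' →
      (profit R' : ℝ) ≤ X) :
    ((q : ℝ) / r + 1) * profit R ≤ 8 * X := by
  classical
  have hr0 : (0 : ℝ) < r := by exact_mod_cast hr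
  obtain ⟨t, rfl⟩ := Nat.exists_eq_add_of_le hrq
  set A : Finset (Fin n × ℝ) := R.toFinset with hA
  have hAcard : A.card = profit R := List.toFinset_card_of_nodup (List.Nodup.of_map _ hR.1)
  have hAmem : ∀ p ∈ A, p ∈ R := fun p hp => List.mem_toFinset.1 hp
  have hinj : Set.InjOn Prod.fst (A : Set (Fin n × ℝ)) := by
    intro p hp p' hp' h
    exact List.inj_on_of_nodup_map hR.1 (hAmem p hp) (hAmem p' hp') h
  have hd : ∀ p ∈ A, ∀ p' ∈ A, dist (I p.1).node (I p'.1).node ≤ |p.2 - p'.2| := by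
    intro p hp p' hp'
    simpa using hR.dist_le zero_le_one (hAmem p hp) (hAmem p' hp')
  -- `m p - r, …, m p - 1` are the rounded delays of the stop `p` over the `r` shifts
  set m : Fin n × ℝ → ℤ := fun p =>
    ⌊r * ((p.2 - (I p.1).start) / α) + Int.fract (r * (((I p.1).start - θ) / α))⌋ with hm
  set N : Fin n × ℝ → ℤ := fun p => ⌊r * (((I p.1).start - θ) / α)⌋ with hN
  have hfloor : ∀ (p : Fin n × ℝ) (j : ℕ),
      ⌊r * ((p.2 - (θ + j * α / r)) / α - firstPeriod α (θ + j * α / r) (I p.1))⌋ =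
        m p + (((N p - j) % r).toNat : ℕ) - r := by
    intro p j
    rw [mul_delay hα hr]
    rw [Int.floor_sub_natCast, Int.floor_add_natCast]
  have hm0 : ∀ p ∈ A, 0 ≤ m p := by
    intro p hp
    have h := (hR.2.1 p (hAmem p hp)).1
    refine Int.floor_nonneg.2 (add_nonneg (mul_nonneg hr0.le (div_nonneg ?_ hα.le))
      (Int.fract_nonneg _))
    linarith
  have hm3 : ∀ p ∈ A, m p ≤ 3 * r := by
    intro p hp
    -- the shift for which the delay is largest
    set j : ℕ := ((N p - (r - 1 : ℕ)) % r).toNat with hj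
    have hjr : j < r := toNat_emod_lt hr _
    have h1 := delay_lt_three hα (hW p.1 j hjr) (hR.2.1 p (hAmem p hp)).2
    have h2 : (r : ℝ) * ((p.2 - (θ + j * α / r)) / α - firstPeriod α (θ + j * α / r) (I p.1)) <
        ((3 * r : ℤ) : ℝ) := by
      push_cast
      rw [mul_comm (3 : ℝ)]
      exact mul_lt_mul_of_pos_left h1 hr0
    have h3 := Int.floor_lt.2 h2
    rw [hfloor, hj, sub_emod_sub_emod (by omega)] at h3
    omega
  have hcov : ∀ b c' : ℤ, 0 ≤ c' → c' ≤ t →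
      ∑ p ∈ A, (coverage r t (m p) b c' : ℝ) ≤ 2 * r * X := by
    intro b c' hc0 hct
    have hj : ∀ j ∈ Finset.range r,
        ∑ p ∈ A, (((if b ≤ m p + (((N p - j) % r).toNat : ℕ) - r ∧
            m p + (((N p - j) % r).toNat : ℕ) - r < b + r + t then (1 : ℤ) else 0) +
          (if b + c' ≤ m p + (((N p - j) % r).toNat : ℕ) - r ∧
            m p + (((N p - j) % r).toNat : ℕ) - r < b + c' + r then (1 : ℤ) else 0) : ℤ) : ℝ)
        ≤ 2 * X := by
      intro j hj
      have hjr := Finset.mem_range.1 hj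
      have h := sum_zigzag_le (s := s) (X := X) (I := I)
        (T := trim α (θ + j * α / r) c I) (A := A) (θ := θ + j * α / r)
        (K := fun p => firstPeriod α (θ + j * α / r) (I p.1))
        (β := b / r) (c := c' / r) (τ := t / r) hα hinj hd (by
          intro p hp
          simp only [trim, trimRequest, hW p.1 j hjr, hc]
          congr 1
          push_cast
          ring) (by
          have : (0 : ℝ) ≤ c' := by exact_mod_cast hc0
          positivity) (by
          have : (c' : ℝ) ≤ t := by exact_mod_cast hct
          gcongr) (by
          refine le_trans (le_of_eq ?_) hs
          push_cast
          field_simp) (hX j hjr)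
      refine le_trans (le_of_eq (Finset.sum_congr rfl fun p hp => ?_)) h
      rw [← hfloor p j]
      have e1 : (b : ℝ) / r + 1 + t / r = ((b + r + t : ℤ) : ℝ) / r := by
        push_cast
        field_simp
      have e2 : (b : ℝ) / r + c' / r = ((b + c' : ℤ) : ℝ) / r := by
        push_cast
        field_simp
      have e3 : ((b + c' : ℤ) : ℝ) / r + 1 = ((b + c' + r : ℤ) : ℝ) / r := by
        push_cast
        field_simp
      rw [e1, e2, e3]
      simp only [div_le_and_lt_div_iff hr0]
      push_cast
      rfl
    have hsum := Finset.sum_le_sum hj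
    rw [Finset.sum_comm] at hsum
    simp only [Finset.sum_const, Finset.card_range, nsmul_eq_mul] at hsum
    refine le_trans (le_of_eq (Finset.sum_congr rfl fun p hp => ?_)) (hsum.trans_eq (by ring))
    rw [← Int.cast_sum, sum_range_sub_emod hr (N p) (fun i : ℕ =>
      (if b ≤ m p + (i : ℤ) - r ∧ m p + (i : ℤ) - r < b + r + t then (1 : ℤ) else 0) +
      (if b + c' ≤ m p + (i : ℤ) - r ∧ m p + (i : ℤ) - r < b + c' + r then (1 : ℤ) else 0)),
      Finset.sum_add_distrib, sum_range_ite_mem_Ico _ _ (by omega),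
      sum_range_ite_mem_Ico _ _ (by omega)]
    unfold coverage
    congr 1
    ring_nf
  have hmain : (profit R : ℝ) * (6 * (2 * r + t)) ≤ 24 * (2 * r * X) := by
    rw [← hAcard, ← nsmul_eq_mul, ← Finset.sum_const]
    rcases le_total (2 * t) r with h2 | h2
    · have hp : ∀ p ∈ A, (6 * (2 * r + t) : ℝ) ≤ 6 * coverage r t (m p) (-r) 0
          + 2 * coverage r t (m p) (-2 * t) t
          + coverage r t (m p) 0 0 + 3 * coverage r t (m p) t 0
          + 6 * coverage r t (m p) (2 * r - t) t + 2 * coverage r t (m p) (r + t) 0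
          + coverage r t (m p) (r - t) t + 3 * coverage r t (m p) (r - 2 * t) t := by
        intro p hp
        exact_mod_cast coverage_of_two_mul_le (r := r) (t := t) (by omega) (by omega) (by omega)
          (hm0 p hp) (hm3 p hp)
      refine (Finset.sum_le_sum hp).trans ?_
      simp only [Finset.sum_add_distrib, ← Finset.mul_sum]
      linarith [hcov (-r) 0 le_rfl (by omega), hcov (-2 * t) t (by omega) le_rfl,
        hcov 0 0 le_rfl (by omega), hcov t 0 le_rfl (by omega),
        hcov (2 * r - t) t (by omega) le_rfl, hcov (r + t) 0 le_rfl (by omega),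
        hcov (r - t) t (by omega) le_rfl, hcov (r - 2 * t) t (by omega) le_rfl]
    · have hp : ∀ p ∈ A, (6 * (2 * r + t) : ℝ) ≤ 6 * coverage r t (m p) (-r) 0
          + 2 * coverage r t (m p) (-r) t + 4 * coverage r t (m p) t 0
          + 6 * coverage r t (m p) (2 * r - t) t + 2 * coverage r t (m p) (2 * r - t) 0
          + 4 * coverage r t (m p) (r - 2 * t) t := by
        intro p hp
        exact_mod_cast coverage_of_le_two_mul (r := r) (t := t) (by omega) (by omega) (by omega)
          (hm0 p hp) (hm3 p hp)
      refine (Finset.sum_le_sum hp).trans ?_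
      simp only [Finset.sum_add_distrib, ← Finset.mul_sum]
      linarith [hcov (-r) 0 le_rfl (by omega), hcov (-r) t (by omega) le_rfl,
        hcov t 0 le_rfl (by omega), hcov (2 * r - t) t (by omega) le_rfl,
        hcov (2 * r - t) 0 le_rfl (by omega), hcov (r - 2 * t) t (by omega) le_rfl]
  have e : ((r + t : ℕ) : ℝ) / r + 1 = (2 * r + t) / r := by
    push_cast
    field_simp
    ring
  rw [e, div_mul_eq_mul_div, div_le_iff₀ hr0]
  linarith

/-! ### Trimming -/

/-- A trimming choice is admissible if it selects one of the periods that are filled. -/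
def ValidChoice (c : List ℕ) : Prop := ∀ ℓ j, keptPeriod c ℓ = some j → 1 ≤ j ∧ j ≤ ℓ

theorem isTrimmed_trim {V : Type*} {n : ℕ} {α : ℝ} (hα : 0 < α) (θ : ℝ) (c : List ℕ)
    (I : Instance V n) : IsTrimmed (trim α θ c I) := by
  refine ⟨α, θ, hα, fun p => ?_⟩
  unfold trim trimRequest
  split
  · exact Or.inl le_rfl
  · exact Or.inr ⟨_, rfl, rfl⟩

theorem trimRequest_node {V : Type*} (α θ : ℝ) (c : List ℕ) (a : Request V) :
    (trimRequest α θ c a).node = a.node := by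
  unfold trimRequest
  split <;> rfl

theorem mem_window_of_mem_trimRequest {V : Type*} {α θ x : ℝ} (hα : 0 < α) {c : List ℕ}
    (hc : ValidChoice c) {a : Request V}
    (hx : x ∈ Set.Ico (trimRequest α θ c a).start (trimRequest α θ c a).finish) :
    x ∈ Set.Ico a.start a.finish := by
  unfold trimRequest at hx
  split at hx
  · simp at hx
  · rename_i j hj
    obtain ⟨h1, h2⟩ := hc _ _ hj
    simp only [toPeriod, Set.mem_Ico] at hx
    push_cast at hx
    have hK : firstPeriod α θ a ≤ firstPeriod α θ a + j - 1 := by omega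
    have hF : firstPeriod α θ a + j ≤ ⌊(a.finish - θ) / α⌋ := by
      unfold fullPeriods at h2
      omega
    have hstart : a.start < θ + firstPeriod α θ a * α := by
      have := Int.lt_floor_add_one ((a.start - θ) / α)
      rw [div_lt_iff₀ hα] at this
      unfold firstPeriod
      push_cast
      linarith
    have hfinish : θ + ((firstPeriod α θ a : ℝ) + j) * α ≤ a.finish := by
      have := Int.le_floor.1 hF
      rw [le_div_iff₀ hα] at this
      push_cast at this
      linarith
    have hj1 : (1 : ℝ) ≤ j := by exact_mod_cast h1
    have : 0 ≤ ((j : ℝ) - 1) * α := mul_nonneg (by linarith) hα.le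
    constructor <;> nlinarith [hx.1, hx.2]

theorem IsRun.of_trim {V : Type*} [PseudoMetricSpace V] {n : ℕ} {s α θ : ℝ} (hα : 0 < α)
    {c : List ℕ} (hc : ValidChoice c) {I : Instance V n} {R : Run n}
    (hR : IsRun s (trim α θ c I) R) : IsRun s I R := by
  refine ⟨hR.1, fun p hp => mem_window_of_mem_trimRequest hα hc (hR.2.1 p hp), ?_⟩
  simpa only [trim, trimRequest_node] using hR.2.2

theorem IsRun.length_le {V : Type*} [PseudoMetricSpace V] {n : ℕ} {s : ℝ} {I : Instance V n}
    {R : Run n} (hR : IsRun s I R) : R.length ≤ n := by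
  simpa using hR.1.length_le_card

/-! ### Essentially different shifts -/

theorem floor_sub_of_mem_Ico {a φ : ℝ} (h0 : 0 ≤ φ) (h1 : φ < 1) :
    ⌊a - φ⌋ = ⌊a⌋ - if φ ≤ Int.fract a then 0 else 1 := by
  have h2 := Int.fract_nonneg a
  have h3 := Int.fract_lt_one a
  have h4 := Int.floor_add_fract a
  rw [Int.floor_eq_iff]
  push_cast
  split_ifs <;> constructor <;> linarith

/-- If the window endpoints lie in corresponding periods for the starting points `θ₁` and `θ₂`,
then the trimmed instances are translates of each other. -/
theorem exists_isRun_trim_of_floor_eq {V : Type*} [PseudoMetricSpace V] {n : ℕ} {s α θ₁ θ₂ : ℝ}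
    {I : Instance V n} {z : ℤ} (c : List ℕ)
    (hstart : ∀ p, ⌊((I p).start - θ₂) / α⌋ = ⌊((I p).start - θ₁) / α⌋ + z)
    (hfinish : ∀ p, ⌊((I p).finish - θ₂) / α⌋ = ⌊((I p).finish - θ₁) / α⌋ + z)
    {R : Run n} (hR : IsRun s (trim α θ₁ c I) R) :
    ∃ R', IsRun s (trim α θ₂ c I) R' ∧ profit R' = profit R := by
  have hfirst : ∀ p, firstPeriod α θ₂ (I p) = firstPeriod α θ₁ (I p) + z := by
    intro p
    rw [firstPeriod, firstPeriod, hstart]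
    ring
  have hfull : ∀ p, fullPeriods α θ₂ (I p) = fullPeriods α θ₁ (I p) := by
    intro p
    rw [fullPeriods, fullPeriods, hfirst, hfinish]
    congr 1
    ring
  refine ⟨R.map fun p => (p.1, p.2 + (θ₂ - θ₁ + z * α)), ⟨?_, ?_, ?_⟩, by simp [profit]⟩
  · rw [List.map_map]
    exact hR.1
  · intro x hx
    obtain ⟨p, hp, rfl⟩ := List.mem_map.1 hx
    have h := hR.2.1 p hp
    simp only [trim, trimRequest, hfull, hfirst] at h ⊢
    split at h
    · simp at h
    · simp only [toPeriod, Set.mem_Ico] at h ⊢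
      push_cast at h ⊢
      constructor <;> linarith [h.1, h.2]
  · rw [List.isChain_map]
    refine hR.2.2.imp fun p p' h => ?_
    simp only [trim, trimRequest_node] at h ⊢
    rwa [add_sub_add_right_eq_sub]

theorem mem_endpointResidues {V : Type*} {n : ℕ} {α θ : ℝ} {I : Instance V n} {y : ℝ} :
    y ∈ endpointResidues α θ I ↔
      ∃ x, (∃ p, x = (I p).start ∨ x = (I p).finish) ∧ residue α θ x = y := by
  unfold endpointResidues
  rw [List.mem_append, List.mem_ofFn, List.mem_ofFn]
  constructor
  · rintro (⟨p, hp⟩ | ⟨p, hp⟩)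
    exacts [⟨_, ⟨p, Or.inl rfl⟩, hp⟩, ⟨_, ⟨p, Or.inr rfl⟩, hp⟩]
  · rintro ⟨x, ⟨p, rfl | rfl⟩, hx⟩
    exacts [Or.inl ⟨p, hx⟩, Or.inr ⟨p, hx⟩]

/-- Every set of periods is essentially the same as one that has a division at a window endpoint:
move the divisions forward until one of them meets an endpoint. -/
theorem exists_residue_floor_eq {V : Type*} {n : ℕ} (hn : 0 < n) {α : ℝ} (hα : 0 < α)
    (θ θ' : ℝ) (I : Instance V n) :
    ∃ δ ∈ endpointResidues α θ I, ∃ z : ℤ, ∀ x, (∃ p, x = (I p).start ∨ x = (I p).finish) →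
      ⌊(x - (θ + δ)) / α⌋ = ⌊(x - θ') / α⌋ + z := by
  classical
  set φ : ℝ := Int.fract ((θ' - θ) / α) with hφ
  set w : ℤ := ⌊(θ' - θ) / α⌋ with hw
  have hleft : ∀ x, ⌊(x - θ') / α⌋ =
      ⌊(x - θ) / α⌋ - w - if φ ≤ Int.fract ((x - θ) / α) then 0 else 1 := by
    intro x
    have e : (x - θ') / α = (x - θ) / α - φ - w := by
      have h : (θ' - θ) / α = w + φ := (Int.floor_add_fract _).symm
      have : (x - θ') / α = (x - θ) / α - (θ' - θ) / α := by ring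
      rw [this, h]
      ring
    rw [e, Int.floor_sub_intCast, floor_sub_of_mem_Ico (Int.fract_nonneg _) (Int.fract_lt_one _)]
    ring
  have hright : ∀ x x₀, ⌊(x - (θ + residue α θ x₀)) / α⌋ = ⌊(x - θ) / α⌋ -
      if Int.fract ((x₀ - θ) / α) ≤ Int.fract ((x - θ) / α) then 0 else 1 := by
    intro x x₀
    have e : (x - (θ + residue α θ x₀)) / α = (x - θ) / α - Int.fract ((x₀ - θ) / α) := by
      unfold residue
      field_simp
      ring
    rw [e, floor_sub_of_mem_Ico (Int.fract_nonneg _) (Int.fract_lt_one _)]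
  set E : Finset ℝ := Finset.univ.image (fun p => (I p).start) ∪
    Finset.univ.image (fun p => (I p).finish) with hE
  have hmem : ∀ x, x ∈ E ↔ ∃ p, x = (I p).start ∨ x = (I p).finish := by
    intro x
    simp only [hE, Finset.mem_union, Finset.mem_image, Finset.mem_univ, true_and, exists_or,
      eq_comm (a := x)]
  by_cases hex : (E.filter fun x => φ ≤ Int.fract ((x - θ) / α)).Nonempty
  · obtain ⟨x₀, hx₀, hmin⟩ := Finset.exists_min_image _ (fun x => Int.fract ((x - θ) / α)) hex
    rw [Finset.mem_filter] at hx₀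
    refine ⟨residue α θ x₀, mem_endpointResidues.2 ⟨x₀, (hmem x₀).1 hx₀.1, rfl⟩, w, ?_⟩
    intro x hx
    rw [hleft, hright]
    have hiff : Int.fract ((x₀ - θ) / α) ≤ Int.fract ((x - θ) / α) ↔
        φ ≤ Int.fract ((x - θ) / α) :=
      ⟨fun h => hx₀.2.trans h, fun h => hmin x (Finset.mem_filter.2 ⟨(hmem x).2 hx, h⟩)⟩
    simp only [hiff]
    ring
  · -- no endpoint is met within the period, so the first division met is in the next one
    have hE0 : E.Nonempty := ⟨_, (hmem _).2 ⟨⟨0, hn⟩, Or.inl rfl⟩⟩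
    obtain ⟨x₀, hx₀, hmin⟩ := Finset.exists_min_image E (fun x => Int.fract ((x - θ) / α)) hE0
    refine ⟨residue α θ x₀, mem_endpointResidues.2 ⟨x₀, (hmem x₀).1 hx₀, rfl⟩, w + 1, ?_⟩
    intro x hx
    rw [hleft, hright, if_pos (hmin x ((hmem x).2 hx)), if_neg]
    · ring
    · intro h
      exact hex ⟨x, Finset.mem_filter.2 ⟨(hmem x).2 hx, h⟩⟩

theorem residue_add_mul_int {α : ℝ} (hα : 0 < α) (θ x : ℝ) (z : ℤ) :
    residue α θ (x + α * z) = residue α θ x := by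
  unfold residue
  have : (x + α * z - θ) / α = (x - θ) / α + z := by
    field_simp
    ring
  rw [this, Int.fract_add_intCast]

open Classical in
/-- If `k` half units make a multiple of `α`, then an endpoint has at most `k` residues modulo `α`
for each residue modulo `1 / 2`. -/
theorem card_endpointResidues_le {V : Type*} {n : ℕ} {α : ℝ} (hα : 0 < α) (θ : ℝ)
    (I : Instance V n) {k : ℕ} (hk : 0 < k) (hkα : ∃ w : ℤ, (k : ℝ) / 2 = α * w) :
    (endpointResidues α θ I).toFinset.card ≤ k * numPeriodSets I := by
  obtain ⟨w, hw⟩ := hkα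
  have hsub : (endpointResidues α θ I).toFinset ⊆
      ((Finset.range k) ×ˢ (endpointResidues (1 / 2) 0 I).toFinset).image
        fun y : ℕ × ℝ => residue α θ (y.2 + y.1 / 2) := by
    intro y hy
    obtain ⟨x, hx, rfl⟩ := mem_endpointResidues.1 (List.mem_toFinset.1 hy)
    set z : ℤ := ⌊(x - 0) / (1 / 2)⌋ with hz
    have hk' : (0 : ℤ) < k := by exact_mod_cast hk
    have hz0 := Int.emod_nonneg z hk'.ne'
    have hzk := Int.emod_lt_of_pos z hk'
    refine Finset.mem_image.2 ⟨((z % k).toNat, residue (1 / 2) 0 x), ?_, ?_⟩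
    · refine Finset.mem_product.2 ⟨Finset.mem_range.2 (by simp only; omega), ?_⟩
      exact List.mem_toFinset.2 (mem_endpointResidues.2 ⟨x, hx, rfl⟩)
    · have hcast : (((z % k).toNat : ℕ) : ℝ) = (z % k : ℤ) := by
        exact_mod_cast Int.toNat_of_nonneg hz0
      have hdiv : (z : ℝ) = k * (z / k : ℤ) + (z % k : ℤ) := by
        exact_mod_cast (Int.mul_ediv_add_emod z k).symm
      have hfr : residue (1 / 2) 0 x = x - z / 2 := by
        unfold residue
        rw [Int.fract, ← hz]
        ring
      have e : x = (residue (1 / 2) 0 x + ((z % k).toNat : ℕ) / 2) + α * (w * (z / k) : ℤ) := by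
        rw [hcast, hfr]
        push_cast
        rw [← mul_assoc, ← hw]
        linarith
      conv_rhs => rw [e]
      rw [residue_add_mul_int hα]
  refine (Finset.card_le_card hsub).trans (Finset.card_image_le.trans ?_)
  rw [Finset.card_product, Finset.card_range]
  exact le_rfl

theorem numPeriodSets_pos {V : Type*} {n : ℕ} (hn : 0 < n) (I : Instance V n) :
    0 < numPeriodSets I := by
  classical
  unfold numPeriodSets
  refine Finset.card_pos.2 ⟨residue (1 / 2) 0 (I ⟨0, hn⟩).start, ?_⟩
  exact List.mem_toFinset.2 (mem_endpointResidues.2 ⟨_, ⟨⟨0, hn⟩, Or.inl rfl⟩, rfl⟩)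

/-! ### Analysis of the algorithm -/

theorem Timed.val_bind {β δ : Type} (x : Timed β) (f : β → Timed δ) :
    (x >>= f).val = (f x.val).val := rfl

theorem Timed.steps_bind {β δ : Type} (x : Timed β) (f : β → Timed δ) :
    (x >>= f).steps = x.steps + (f x.val).steps := rfl

theorem Timed.val_pure {β : Type} (x : β) : (pure x : Timed β).val = x := rfl

theorem Timed.steps_pure {β : Type} (x : β) : (pure x : Timed β).steps = 0 := rfl

theorem steps_tick (k : ℕ) : (tick k).steps = k := rfl

/-- The `r` equally spaced shifts `0, α / r, …, (r - 1) α / r`. -/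
def gridShifts (r : ℕ) (α : ℝ) : List ℝ := (List.range r).map fun j : ℕ => j * α / r

open Classical in
/-- The search for shifts ends with the equally spaced shifts or with all residues, and the number
of shifts does not exceed the number of distinct residues. -/
theorem shifts_spec (r : Option ℕ) (α : ℝ) (l : List ℝ) : ∀ acc : List ℝ, acc.Nodup →
    (∀ k, r = some k → acc.length < k) →
    acc.length ≤ (shifts r α acc l).val.length ∧
    (shifts r α acc l).val.length ≤ (acc.toFinset ∪ l.toFinset).card ∧
    (∀ k, r = some k → (shifts r α acc l).val.length ≤ k) ∧
    (shifts r α acc l).steps ≤ 2 * l.length * ((shifts r α acc l).val.length + 1) ∧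
    ((∃ k, r = some k ∧ (shifts r α acc l).val = gridShifts k α) ∨
      ∀ x, x ∈ acc ∨ x ∈ l → x ∈ (shifts r α acc l).val) := by
  induction l with
  | nil =>
    intro acc hacc hr
    simp only [shifts, Timed.val_pure, Timed.steps_pure]
    refine ⟨le_rfl, ?_, fun k hk => (hr k hk).le, by omega, Or.inr ?_⟩
    · simp [List.toFinset_card_of_nodup hacc]
    · rintro x (hx | hx)
      · exact hx
      · simp at hx
  | cons x l ih =>
    intro acc hacc hr
    simp only [shifts, Timed.val_bind, Timed.steps_bind, steps_tick]
    split_ifs with hx hk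
    · obtain ⟨h1, h2, h3, h4, h5⟩ := ih acc hacc hr
      refine ⟨h1, h2.trans (Finset.card_le_card ?_), h3, ?_, ?_⟩
      · intro y
        simp only [Finset.mem_union, List.mem_toFinset, List.mem_cons]
        tauto
      · rw [List.length_cons]
        nlinarith
      · refine h5.imp_right fun h y hy => ?_
        rcases hy with hy | hy
        · exact h y (Or.inl hy)
        · rcases List.mem_cons.1 hy with rfl | hy
          · exact h _ (Or.inl hx)
          · exact h y (Or.inr hy)
    · have hcoe : (do let a ← List.range (acc.length + 1); pure (a : ℝ) : List ℝ) =
          (List.range (acc.length + 1)).map fun a : ℕ => (a : ℝ) := by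
        simp [← List.map_eq_flatMap]
      simp only [Timed.val_bind, Timed.steps_bind, steps_tick, Timed.val_pure, Timed.steps_pure,
        hcoe, List.length_map, List.length_range]
      refine ⟨by omega, ?_, ?_, ?_, Or.inl ⟨_, hk, ?_⟩⟩
      · have hsub : insert x acc.toFinset ⊆ acc.toFinset ∪ (x :: l).toFinset := by
          intro y
          simp only [Finset.mem_insert, Finset.mem_union, List.mem_toFinset, List.mem_cons]
          tauto
        have := Finset.card_le_card hsub
        rwa [Finset.card_insert_of_notMem (by simpa using hx),
          List.toFinset_card_of_nodup hacc] at this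
      · intro k hk'
        rw [hk] at hk'
        exact (Option.some.inj hk').le
      · rw [List.length_cons]
        nlinarith [Nat.zero_le (l.length * (acc.length + 1))]
      · simp [gridShifts, Function.comp_def]
    · obtain ⟨h1, h2, h3, h4, h5⟩ := ih (x :: acc) (List.nodup_cons.2 ⟨hx, hacc⟩) (by
        intro k hk'
        have h := hr k hk'
        rw [List.length_cons]
        rcases (Nat.succ_le_of_lt h).eq_or_lt with h' | h'
        · exact absurd (by rw [hk', ← h']) hk
        · exact h')
      rw [List.length_cons] at h1
      refine ⟨by omega, h2.trans (Finset.card_le_card ?_), h3, ?_, ?_⟩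
      · intro y
        simp only [Finset.mem_union, List.mem_toFinset, List.mem_cons]
        tauto
      · rw [List.length_cons]
        nlinarith
      · refine h5.imp_right fun h y hy => h y ?_
        simp only [List.mem_cons] at hy ⊢
        tauto

section Analysis

variable {V : Type*} [PseudoMetricSpace V] {n : ℕ} {s γ : ℝ} {Γ : ℕ → ℕ} {repairman : Solver V}

theorem bestRun_spec (hsolve : IsApproxSolver s γ Γ repairman) (I : Instance V n) {α : ℝ}
    (hα : 0 < α) (θ : ℝ) {c : List ℕ} (hc : ValidChoice c) (L : List ℝ) :
    ∀ best : Run n, IsRun s I best →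
    IsRun s I (bestRun repairman I α θ c best L).val ∧
    profit best ≤ profit (bestRun repairman I α θ c best L).val ∧
    (bestRun repairman I α θ c best L).steps ≤ L.length * (Γ n + 3 * n + 2) ∧
    ∀ δ ∈ L, profit (repairman n (trim α (θ + δ) c I)).val ≤
      profit (bestRun repairman I α θ c best L).val := by
  induction L with
  | nil =>
    intro best hbest
    simp [bestRun, Timed.val_pure, Timed.steps_pure, hbest]
  | cons δ L ih =>
    intro best hbest
    obtain ⟨h1, -, h3⟩ := hsolve n _ (isTrimmed_trim hα (θ + δ) c I)
    have h1' := h1.of_trim hα hc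
    have hnew : IsRun s I (if profit best < profit (repairman n (trim α (θ + δ) c I)).val then
        (repairman n (trim α (θ + δ) c I)).val else best) := by
      split_ifs
      exacts [h1', hbest]
    obtain ⟨k1, k2, k3, k4⟩ := ih _ hnew
    simp only [bestRun, Timed.val_bind, Timed.steps_bind, steps_tick]
    have hb := hbest.length_le
    have hR := h1'.length_le
    have hp : profit best ≤ profit (if profit best <
        profit (repairman n (trim α (θ + δ) c I)).val then
        (repairman n (trim α (θ + δ) c I)).val else best) ∧
        profit (repairman n (trim α (θ + δ) c I)).val ≤ profit (if profit best <
        profit (repairman n (trim α (θ + δ) c I)).val then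
        (repairman n (trim α (θ + δ) c I)).val else best) := by
      split_ifs with h <;> omega
    refine ⟨k1, hp.1.trans k2, ?_, ?_⟩
    · rw [List.length_cons, add_mul]
      omega
    · intro δ' hδ'
      rcases List.mem_cons.1 hδ' with rfl | hδ'
      · exact hp.2.trans k2
      · exact k4 δ' hδ'

theorem speedup_spec (hsolve : IsApproxSolver s γ Γ repairman) (hΓ : n ≤ Γ n) (hn : 0 < n)
    {r : Option ℕ} (hr : ∀ k, r = some k → 0 < k) (I : Instance V n) {best : Run n}
    (hbest : IsRun s I best) {α : ℝ} (hα : 0 < α) (θ : ℝ) {c : List ℕ} (hc : ValidChoice c)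
    {M : ℕ} (hM0 : 0 < M)
    (hM : (shifts r α [] (endpointResidues α θ I)).val.length ≤ M) :
    IsRun s I (speedup repairman r I best α θ c).val ∧
    profit best ≤ profit (speedup repairman r I best α θ c).val ∧
    (speedup repairman r I best α θ c).steps ≤ 16 * (M * Γ n) ∧
    ∀ δ ∈ (shifts r α [] (endpointResidues α θ I)).val,
      profit (repairman n (trim α (θ + δ) c I)).val ≤
        profit (speedup repairman r I best α θ c).val := by
  classical
  obtain ⟨-, -, -, h4, -⟩ := shifts_spec r α (endpointResidues α θ I) [] List.nodup_nil hr
  obtain ⟨k1, k2, k3, k4⟩ := bestRun_spec hsolve I hα θ hc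
    (shifts r α [] (endpointResidues α θ I)).val best hbest
  simp only [speedup, Timed.val_bind, Timed.steps_bind, steps_tick]
  refine ⟨k1, k2, ?_, k4⟩
  set len := (shifts r α [] (endpointResidues α θ I)).val.length with hlen
  have hl : (endpointResidues α θ I).length = 2 * n := by
    simp [endpointResidues]
    omega
  rw [hl] at h4
  have h1 : 2 * (2 * n) * (len + 1) ≤ 8 * (M * Γ n) := by
    calc 2 * (2 * n) * (len + 1) ≤ 2 * (2 * Γ n) * (M + M) := by gcongr; omega
      _ = 8 * (M * Γ n) := by ring
  have h2 : len * (Γ n + 3 * n + 2) ≤ 6 * (M * Γ n) := by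
    calc len * (Γ n + 3 * n + 2) ≤ M * (6 * Γ n) := Nat.mul_le_mul hM (by omega)
      _ = 6 * (M * Γ n) := by ring
  have h3 : n ≤ M * Γ n := hΓ.trans (Nat.le_mul_of_pos_left _ hM0)
  omega

theorem runCalls_spec (hsolve : IsApproxSolver s γ Γ repairman) (hΓ : n ≤ Γ n) (hn : 0 < n)
    {r : Option ℕ} (hr : ∀ k, r = some k → 0 < k) (I : Instance V n) {M : ℕ} (hM0 : 0 < M)
    (l : List (ℝ × ℝ × List ℕ))
    (hl : ∀ a ∈ l, 0 < a.1 ∧ ValidChoice a.2.2 ∧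
      (shifts r a.1 [] (endpointResidues a.1 a.2.1 I)).val.length ≤ M) :
    ∀ best : Run n, IsRun s I best →
    IsRun s I (runCalls repairman r I best l).val ∧
    profit best ≤ profit (runCalls repairman r I best l).val ∧
    (runCalls repairman r I best l).steps ≤ l.length * (17 * (M * Γ n)) ∧
    ∀ a ∈ l, ∀ δ ∈ (shifts r a.1 [] (endpointResidues a.1 a.2.1 I)).val,
      profit (repairman n (trim a.1 (a.2.1 + δ) a.2.2 I)).val ≤
        profit (runCalls repairman r I best l).val := by
  induction l with
  | nil =>
    intro best hbest
    simp [runCalls, Timed.val_pure, Timed.steps_pure, hbest]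
  | cons a l ih =>
    intro best hbest
    obtain ⟨α, θ, c⟩ := a
    obtain ⟨hα, hc, hM⟩ : 0 < α ∧ ValidChoice c ∧
        (shifts r α [] (endpointResidues α θ I)).val.length ≤ M := hl _ List.mem_cons_self
    obtain ⟨h1, h2, h3, h4⟩ := speedup_spec hsolve hΓ hn hr I hbest hα θ hc hM0 hM
    obtain ⟨k1, k2, k3, k4⟩ := ih (fun a ha => hl a (List.mem_cons_of_mem _ ha)) _ h1
    simp only [runCalls, Timed.val_bind, Timed.steps_bind, steps_tick]
    refine ⟨k1, h2.trans k2, ?_, ?_⟩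
    · have : 1 ≤ M * Γ n := Nat.mul_pos hM0 (by omega)
      rw [List.length_cons, add_mul]
      omega
    · intro a ha δ hδ
      rcases List.mem_cons.1 ha with rfl | ha
      · exact (h4 δ hδ).trans k2
      · exact k4 a ha δ hδ

end Analysis

/-! ### Approximation guarantee and running time -/

theorem calls_spec : ∀ a ∈ calls, 0 < a.1 ∧ ValidChoice a.2.2 ∧
    ∃ k : ℕ, 0 < k ∧ k ≤ 3 ∧ ∃ w : ℤ, (k : ℝ) / 2 = a.1 * w := by
  have hvalid : ∀ c : List ℕ, (∀ i < c.length, 1 ≤ c.getD i 0 ∧ c.getD i 0 ≤ i + 1) →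
      ValidChoice c := by
    intro c hc ℓ j h
    cases ℓ with
    | zero => simp [keptPeriod] at h
    | succ ℓ =>
      simp only [keptPeriod] at h
      obtain ⟨hlt, hj⟩ := List.getElem?_eq_some_iff.1 h
      have := hc ℓ hlt
      rwa [List.getD_eq_getElem _ _ hlt, hj] at this
  intro a ha
  unfold calls at ha
  simp only [List.mem_append, List.mem_flatMap, List.mem_map, List.mem_cons, List.not_mem_nil,
    or_false] at ha
  rcases ha with (⟨i, -, j, hj, k, hk, rfl⟩ | ⟨i, -, j, hj, rfl⟩) | ⟨i, -, rfl⟩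
  · refine ⟨by norm_num, hvalid _ ?_, 1, by norm_num, by norm_num, 1, by norm_num⟩
    intro x hx
    simp only [List.length_cons, List.length_nil] at hx
    interval_cases x <;> simp <;> omega
  · refine ⟨by norm_num, hvalid _ ?_, 3, by norm_num, by norm_num, 2, by norm_num⟩
    intro x hx
    simp only [List.length_cons, List.length_nil] at hx
    interval_cases x
    · simp
    · simp
      omega
  · refine ⟨by norm_num, hvalid _ ?_, 2, by norm_num, by norm_num, 1, by norm_num⟩
    intro x hx
    simp only [List.length_cons, List.length_nil] at hx
    interval_cases x
    simp

theorem length_calls : calls.length = 22 := by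
  simp [calls]

theorem half_mem_calls {i : ℕ} (hi : i < 2) :
    ((1 / 2, (i : ℝ) / 4, [1, 1, 1]) : ℝ × ℝ × List ℕ) ∈ calls := by
  unfold calls
  simp only [List.mem_append, List.mem_flatMap, List.mem_map]
  exact Or.inl (Or.inl ⟨i, by simpa using hi, 1, by simp, 1, by simp, rfl⟩)

open Classical in
theorem length_shifts_le {V : Type*} {n : ℕ} {r : Option ℕ} (hr : ∀ k, r = some k → 0 < k) (I : Instance V n)
    {a : ℝ × ℝ × List ℕ} (ha : a ∈ calls) :
    (shifts r a.1 [] (endpointResidues a.1 a.2.1 I)).val.length ≤ 3 * numPeriodSets I := by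
  obtain ⟨-, h2, -⟩ := shifts_spec r a.1 (endpointResidues a.1 a.2.1 I) [] List.nodup_nil hr
  obtain ⟨hα, -, k, hk0, hk3, hw⟩ := calls_spec a ha
  refine h2.trans ?_
  rw [List.toFinset_nil, Finset.empty_union]
  exact (card_endpointResidues_le hα _ I hk0 hw).trans (Nat.mul_le_mul_right _ hk3)

section Guarantee

variable {V : Type*} [PseudoMetricSpace V] {n : ℕ} {s γ : ℝ} {Γ : ℕ → ℕ} {repairman : Solver V}

/-- An instance with a single request forces the approximation factor to be positive. -/
theorem IsApproxSolver.factor_pos (hsolve : IsApproxSolver s γ Γ repairman) (v : V) : 0 < γ := by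
  set T : Instance V 1 := fun _ => ⟨v, 0, 1⟩ with hT
  have htrim : IsTrimmed T := ⟨1, 0, one_pos, fun p => Or.inr ⟨0, by simp [hT], by simp [hT]⟩⟩
  obtain ⟨-, h, -⟩ := hsolve 1 T htrim
  have h1 := h [(0, 0)] ⟨by simp, by simp [hT], by simp⟩
  by_contra hγ
  have : γ * (profit (repairman 1 T).val : ℝ) ≤ 0 :=
    mul_nonpos_of_nonpos_of_nonneg (not_lt.1 hγ) (Nat.cast_nonneg _)
  simp [profit] at h1 this
  linarith

/-- The algorithm is fast if every call tries at most `M` shifts, and up to the factor `γ` its run is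
at least as good as every run in the trimmed instances that it tries. -/
theorem speedupW12_spec (hsolve : IsApproxSolver s γ Γ repairman) (hΓ : n ≤ Γ n) (hn : 0 < n)
    {r : Option ℕ} (hr : ∀ k, r = some k → 0 < k) (I : Instance V n) {M : ℕ} (hM0 : 0 < M)
    (hM : ∀ a ∈ calls, (shifts r a.1 [] (endpointResidues a.1 a.2.1 I)).val.length ≤ M) :
    IsRun s I (speedupW12 repairman r I).val ∧
    (speedupW12 repairman r I).steps ≤ 22 * (17 * (M * Γ n)) ∧
    ∀ a ∈ calls, ∀ δ ∈ (shifts r a.1 [] (endpointResidues a.1 a.2.1 I)).val,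
      ∀ R : Run n, IsRun s (trim a.1 (a.2.1 + δ) a.2.2 I) R →
        (profit R : ℝ) ≤ γ * profit (speedupW12 repairman r I).val := by
  obtain ⟨h1, -, h3, h4⟩ := runCalls_spec hsolve hΓ hn hr I hM0 calls
    (fun a ha => ⟨(calls_spec a ha).1, (calls_spec a ha).2.1, hM a ha⟩) []
    ⟨by simp, by simp, by simp⟩
  rw [length_calls] at h3
  refine ⟨h1, h3, fun a ha δ hδ R hR => ?_⟩
  have hγ := hsolve.factor_pos (I ⟨0, hn⟩).node
  obtain ⟨-, h, -⟩ := hsolve n _ (isTrimmed_trim (calls_spec a ha).1 (a.2.1 + δ) a.2.2 I)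
  exact (h R hR).trans (mul_le_mul_of_nonneg_left (by exact_mod_cast h4 a ha δ hδ) hγ.le)

/-- A bound that holds for the sets of periods with a division at a window endpoint holds for all
sets of periods of the same length. -/
theorem profit_le_of_residues (hn : 0 < n) {α : ℝ} (hα : 0 < α) (θ : ℝ) (c : List ℕ)
    (I : Instance V n) {X : ℝ} (hX : ∀ δ ∈ endpointResidues α θ I,
      ∀ R : Run n, IsRun s (trim α (θ + δ) c I) R → (profit R : ℝ) ≤ X)
    (θ' : ℝ) {R : Run n} (hR : IsRun s (trim α θ' c I) R) : (profit R : ℝ) ≤ X := by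
  obtain ⟨δ, hδ, z, hz⟩ := exists_residue_floor_eq hn hα θ θ' I
  obtain ⟨R', hR', hp⟩ := exists_isRun_trim_of_floor_eq c (fun p => hz _ ⟨p, Or.inl rfl⟩)
    (fun p => hz _ ⟨p, Or.inr rfl⟩) hR
  rw [← hp]
  exact hX δ hδ R' hR'

end Guarantee

/-- A real speed is approximated from below by fractions: if `y * x ≤ B` holds with `y = q / r + 1`
for all fractions `q / r ≤ s` in `[1, 2]`, then it holds with `y = s + 1`. -/
theorem add_one_mul_le_of_fractions {s x B : ℝ} (hs1 : 1 ≤ s) (hs2 : s ≤ 2) (hx : 0 ≤ x)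
    (h : ∀ q r : ℕ, 0 < r → r ≤ q → q ≤ 2 * r → (q : ℝ) / r ≤ s →
      ((q : ℝ) / r + 1) * x ≤ B) :
    (s + 1) * x ≤ B := by
  by_contra! hlt
  have hpos : 0 < (s + 1) * x - B := by linarith
  obtain ⟨r, hr⟩ := exists_nat_gt (x / ((s + 1) * x - B))
  have hr0 : (0 : ℝ) < r := (div_nonneg hx hpos.le).trans_lt hr
  rw [div_lt_iff₀ hpos] at hr
  have hq1 := Nat.floor_le (mul_nonneg (zero_le_one.trans hs1) hr0.le : 0 ≤ s * r)
  have hq2 := Nat.lt_floor_add_one (s * r)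
  have h1 := h ⌊s * r⌋₊ r (by exact_mod_cast hr0)
    (Nat.le_floor (le_mul_of_one_le_left hr0.le hs1))
    (Nat.floor_le_of_le (by push_cast; exact mul_le_mul_of_nonneg_right hs2 hr0.le))
    ((div_le_iff₀ hr0).2 hq1)
  have h2 : (s * r - 1) / r ≤ (⌊s * r⌋₊ : ℝ) / r := by
    gcongr
    linarith
  have h3 : ((s * r - 1) / r + 1) * x ≤ B :=
    (mul_le_mul_of_nonneg_right (by linarith) hx).trans h1
  have e : ((s * r - 1) / r + 1) * x = (s + 1) * x - x / r := by
    field_simp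
    ring
  rw [e] at h3
  have h4 : (s + 1) * x - B ≤ x / r := by linarith
  rw [le_div_iff₀ hr0] at h4
  linarith

end Repairman
end

open Repairman in
theorem mainTheorem3 :
    ∃ C : ℕ, ∀ (V : Type*) [PseudoMetricSpace V] (s γ : ℝ) (Γ : ℕ → ℕ) (repairman : Solver V),
      1 ≤ s → s ≤ 2 → (∀ n, n ≤ Γ n) → IsApproxSolver s γ Γ repairman →
      ∀ (n : ℕ) (_ : 0 < n) (I : Instance V n),
        -- rational speedup
        (∀ q r : ℕ, 0 < r → s = q / r →
          IsRun s I (speedupW12 repairman (some r) I).val ∧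
          (speedupW12 repairman (some r) I).steps ≤ C * (min r (numPeriodSets I) * Γ n) ∧
          ∀ i < 2, (∀ p, ∀ j < r, InW 2 (1 / 2) ((i : ℕ) / 4 + (j : ℕ) / (2 * r)) (I p)) →
            ∀ R : Run n, IsRun 1 I R →
              (profit R : ℝ) ≤
                8 * γ / (s + 1) * profit (speedupW12 repairman (some r) I).val) ∧
        -- arbitrary real speedup
        (IsRun s I (speedupW12 repairman none I).val ∧
          (speedupW12 repairman none I).steps ≤ C * (numPeriodSets I * Γ n) ∧
          ((∀ p, ∀ θ : ℝ, InW 2 (1 / 2) θ (I p)) →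
            ∀ R : Run n, IsRun 1 I R →
              (profit R : ℝ) ≤
                8 * γ / (s + 1) * profit (speedupW12 repairman none I).val)) := by
  classical
  -- 22 calls, each with at most `3 * min r m` shifts at a cost of at most `17 * Γ n` per shift
  refine ⟨22 * 17 * 3, fun V _ s γ Γ repairman hs1 hs2 hΓ hsolve n hn I => ⟨?_, ?_⟩⟩
  · intro q r hr hs
    have hr' : ∀ k, some r = some k → 0 < k := fun k hk => Option.some.inj hk ▸ hr
    have hm := numPeriodSets_pos hn I
    have hM : ∀ a ∈ calls, (shifts (some r) a.1 [] (endpointResidues a.1 a.2.1 I)).val.length ≤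
        3 * min r (numPeriodSets I) := by
      intro a ha
      have h1 := length_shifts_le hr' I ha
      have h2 := (shifts_spec (some r) a.1 (endpointResidues a.1 a.2.1 I) []
        List.nodup_nil hr').2.2.1 r rfl
      omega
    obtain ⟨h1, h2, h3⟩ := speedupW12_spec hsolve (hΓ n) hn hr' I (by omega) hM
    refine ⟨h1, h2.trans_eq (by ring), fun i hi hW R hR => ?_⟩
    have hr0 : (0 : ℝ) < r := by exact_mod_cast hr
    have hrq : r ≤ q := by
      rw [hs, one_le_div hr0] at hs1
      exact_mod_cast hs1
    have hq : q ≤ 2 * r := by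
      rw [hs, div_le_iff₀ hr0] at hs2
      exact_mod_cast hs2
    have hX : ∀ j < r, ∀ R' : Run n,
        IsRun s (trim (1 / 2) ((i : ℝ) / 4 + j * (1 / 2) / r) [1, 1, 1] I) R' →
        (profit R' : ℝ) ≤ γ * profit (speedupW12 repairman (some r) I).val := by
      have h4 := h3 _ (half_mem_calls hi)
      intro j hj R' hR'
      obtain ⟨k, hk, hgrid⟩ | hall := (shifts_spec (some r) (1 / 2)
        (endpointResidues (1 / 2) ((i : ℝ) / 4) I) [] List.nodup_nil hr').2.2.2.2
      · obtain rfl := Option.some.inj hk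
        refine h4 (j * (1 / 2) / r) ?_ R' hR'
        simp only [hgrid]
        exact List.mem_map.2 ⟨j, List.mem_range.2 hj, rfl⟩
      · exact profit_le_of_residues hn one_half_pos _ _ I
          (fun δ hδ => h4 δ (hall δ (Or.inr hδ))) _ hR'
    have h := profit_le_of_shifts one_half_pos hR hr hrq hq hs.ge rfl (fun p j hj => by
      have e : (i : ℝ) / 4 + j / (2 * r) = i / 4 + j * (1 / 2) / r := by field_simp
      rw [← inW_iff_fullPeriods 2 one_half_pos, ← e]
      exact hW p j hj) hX
    rw [div_mul_eq_mul_div, le_div_iff₀ (by linarith), hs]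
    linarith
  · have hr' : ∀ k, (none : Option ℕ) = some k → 0 < k := fun k hk => by simp at hk
    have hm := numPeriodSets_pos hn I
    obtain ⟨h1, h2, h3⟩ := speedupW12_spec hsolve (hΓ n) hn hr' I (by omega)
      (fun a ha => length_shifts_le hr' I ha)
    refine ⟨h1, h2.trans_eq (by ring), fun hW R hR => ?_⟩
    have hX : ∀ (θ : ℝ) (R' : Run n), IsRun s (trim (1 / 2) θ [1, 1, 1] I) R' →
        (profit R' : ℝ) ≤ γ * profit (speedupW12 repairman none I).val := by
      have h4 := h3 _ (half_mem_calls two_pos)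
      intro θ R' hR'
      obtain ⟨k, hk, -⟩ | hall := (shifts_spec none (1 / 2)
        (endpointResidues (1 / 2) (((0 : ℕ) : ℝ) / 4) I) [] List.nodup_nil hr').2.2.2.2
      · simp at hk
      · exact profit_le_of_residues hn one_half_pos _ _ I
          (fun δ hδ => h4 δ (hall δ (Or.inr hδ))) _ hR'
    have h := add_one_mul_le_of_fractions (B := 8 * (γ * profit (speedupW12 repairman none I).val))
      hs1 hs2 (Nat.cast_nonneg (profit R)) (fun q r hr hrq hq hqs =>
        profit_le_of_shifts (θ := 0) one_half_pos hR hr hrq hq hqs rfl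
          (fun p j _ => (inW_iff_fullPeriods 2 one_half_pos _ _).1 (hW p _)) (fun j _ => hX _))
    rw [div_mul_eq_mul_div, le_div_iff₀ (by linarith)]
    linarith
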